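/- Let $\Bbbk$ be an arbitrary field and let $n,m\ge 1$ be integers. For a finite simple graph $G$, let $S(G)$ denote its $1$-subdivision, i.e. the graph obtained from $G$ by replacing every edge by a path of length two: its vertices are the vertices and the edges of $G$, and each edge $e=uv$ of $G$ is adjacent in $S(G)$ exactly to $u$ and to $v$. For a finite graph $H$ with vertex set $V$, let $\operatorname{Ind}(H)$ be its independence complex, the simplicial complex on $V$ whose faces are the independent sets of $H$ (including $\emptyset$), and define the (Castelnuovo–Mumford) regularity of $H$ over $\Bbbk$ by $$\operatorname{reg}_{\Bbbk}(H)=\max\{\,j \;:\; \widetilde H_{j-1}(\operatorname{Ind}(H)[A];\Bbbk)\neq 0\ \text{for some } A\subseteq V\,\},$$ where $\operatorname{Ind}(H)[A]=\{F\in\operatorname{Ind}(H): F\subseteq A\}$ is the induced subcomplex and $\widetilde H_*$ denotes reduced simplicial homology (so that $\widetilde H_{-1}(\{\emptyset\};\Bbbk)=\Bbbk$). Then, for the complete bipartite graph $K_{n,m}$, $$\operatorname{reg}_{\Bbbk}\bigl(S(K_{n,m})\bigr)=n+m-1 .$$ -/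

import Mathlib

/-- The `1`-subdivision graph `S(G)`: every edge `e = uv` of `G` becomes a new vertex `inr e`, adjacent
exactly to its two ends `inl u` and `inl v`. -/
def SimpleGraph.oneSubdivision {V : Type*} (G : SimpleGraph V) : SimpleGraph (V ⊕ G.edgeSet) where
  Adj
    | .inl v, .inr e => v ∈ (e : Sym2 V)
    | .inr e, .inl v => v ∈ (e : Sym2 V)
    | _, _ => False
  symm := ⟨by rintro (u | e) (v | f) h <;> exact h⟩
  loopless := ⟨by rintro (u | e) h <;> exact h⟩

/-- The independence complex `Ind(G)`: the faces are the (finite) independent sets of `G`. As always for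
`AbstractSimplicialComplex`, the empty face is left implicit. -/
def SimpleGraph.indComplex {V : Type*} (G : SimpleGraph V) : AbstractSimplicialComplex V where
  faces := {F | F.Nonempty ∧ G.IsIndepSet (F : Set V)}
  isRelLowerSet_faces := fun _ hF =>
    ⟨hF.1, fun _ hle hne => ⟨hne, hF.2.mono (Finset.coe_subset.2 hle)⟩⟩
  singleton_mem := fun v => ⟨Finset.singleton_nonempty v, by simp [SimpleGraph.IsIndepSet]⟩

namespace SimplicialHomology

/-- The induced subcomplex `X[S] = {F ∈ X : F ⊆ S}`. -/
def induced {V : Type*} (X : PreAbstractSimplicialComplex V) (S : Set V) :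
    PreAbstractSimplicialComplex V where
  faces := {F | F ∈ X ∧ (F : Set V) ⊆ S}
  isRelLowerSet_faces := fun _ hF =>
    ⟨(X.isRelLowerSet_faces hF.1).1, fun _ hle hne =>
      ⟨(X.isRelLowerSet_faces hF.1).2 hle hne, (Finset.coe_subset.2 hle).trans hF.2⟩⟩

section Subquotient

variable {K M : Type*} [Field K] [AddCommGroup M] [Module K M]

/-- For subspaces `B ≤ Z` of a vector space, the quotient space `Z / B`. -/
def Subquotient (Z B : Submodule K M) : Type _ := Z ⧸ B.submoduleOf Z

instance (Z B : Submodule K M) : AddCommGroup (Subquotient Z B) :=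
  inferInstanceAs (AddCommGroup (Z ⧸ B.submoduleOf Z))

instance (Z B : Submodule K M) : Module K (Subquotient Z B) :=
  inferInstanceAs (Module K (Z ⧸ B.submoduleOf Z))

theorem nontrivial_subquotient_iff (Z B : Submodule K M) :
    Nontrivial (Subquotient Z B) ↔ ¬ Z ≤ B := by
  rw [← Submodule.submoduleOf_eq_top]
  exact Submodule.Quotient.nontrivial_iff

end Subquotient

section Chains

variable (𝕜 : Type*) [Field 𝕜] {V : Type*} [LinearOrder V]

/-- The simplicial boundary map
`∂ {v₀ < v₁ < ⋯ < v_d} = ∑ k, (-1) ^ k • {v₀, …, v_d} \ {v_k}`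
on the vector space with basis all finite subsets of the ordered set `V`. The position `k` of a vertex
`v` in `F` is the number of elements of `F` that are smaller than `v`. On a single vertex this is the
augmentation `{v} ↦ ∅`. -/
noncomputable def boundary : (Finset V →₀ 𝕜) →ₗ[𝕜] (Finset V →₀ 𝕜) :=
  Finsupp.lsum 𝕜 fun F => LinearMap.toSpanSingleton 𝕜 (Finset V →₀ 𝕜)
    (∑ v ∈ F, Finsupp.single (F.erase v) ((-1 : 𝕜) ^ (F.filter (· < v)).card))

theorem boundary_single (F : Finset V) (a : 𝕜) : boundary 𝕜 (Finsupp.single F a) =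
    a • ∑ v ∈ F, Finsupp.single (F.erase v) ((-1 : 𝕜) ^ (F.filter (· < v)).card) := by
  simp [boundary]

/-- The augmented simplicial chains of `X` spanned by the faces with `j` vertices, i.e. of dimension
`j - 1`; for `j = 0` they are spanned by the empty face, which every complex has. -/
def chains (X : PreAbstractSimplicialComplex V) (j : ℕ) : Submodule 𝕜 (Finset V →₀ 𝕜) :=
  Finsupp.supported 𝕜 𝕜 {F | F.card = j ∧ (F = ∅ ∨ F ∈ X)}

/-- The reduced cycles of dimension `j - 1`. -/
noncomputable def cycles (X : PreAbstractSimplicialComplex V) (j : ℕ) :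
    Submodule 𝕜 (Finset V →₀ 𝕜) :=
  chains 𝕜 X j ⊓ LinearMap.ker (boundary 𝕜)

/-- The boundaries of dimension `j - 1`. -/
noncomputable def boundaries (X : PreAbstractSimplicialComplex V) (j : ℕ) :
    Submodule 𝕜 (Finset V →₀ 𝕜) :=
  (chains 𝕜 X (j + 1)).map (boundary 𝕜)

/-- The reduced simplicial homology `H̃_{j-1}(X; 𝕜)`, cycles modulo boundaries. -/
abbrev ReducedHomology (X : PreAbstractSimplicialComplex V) (j : ℕ) : Type _ :=
  Subquotient (cycles 𝕜 X j) (boundaries 𝕜 X j)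

theorem boundary_boundary (c : Finset V →₀ 𝕜) : boundary 𝕜 (boundary 𝕜 c) = 0 := by
  induction c using Finsupp.induction_linear with
  | zero => simp
  | add f g hf hg => simp [hf, hg]
  | single F a =>
    rw [boundary_single, map_smul, map_sum]
    simp only [boundary_single, Finset.smul_sum, Finsupp.smul_single, smul_eq_mul]
    have key : ∑ v ∈ F, ∑ w ∈ F.erase v, Finsupp.single ((F.erase v).erase w)
        ((-1 : 𝕜) ^ (F.filter (· < v)).card * (-1) ^ ((F.erase v).filter (· < w)).card) = 0 := by
      rw [Finset.sum_sigma']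
      refine Finset.sum_involution (fun p _ => ⟨p.2, p.1⟩) ?_ ?_ ?_ ?_
      · rintro ⟨v, w⟩ h
        simp only [Finset.mem_sigma, Finset.mem_erase] at h
        obtain ⟨hv, hwv, hw⟩ := h
        simp only
        rw [Finset.erase_right_comm (a := w), ← Finsupp.single_add]
        have aux : ∀ x y : V, x ∈ F → y ∈ F → x < y →
            ((-1 : 𝕜) ^ (F.filter (· < x)).card * (-1) ^ ((F.erase x).filter (· < y)).card +
            (-1) ^ (F.filter (· < y)).card * (-1) ^ ((F.erase y).filter (· < x)).card) = 0 := by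
          intro x y hx hy hxy
          have h1 : (F.erase y).filter (· < x) = F.filter (· < x) := by
            ext z; simp only [Finset.mem_filter, Finset.mem_erase]
            exact ⟨fun h => ⟨h.1.2, h.2⟩, fun h => ⟨⟨(h.2.trans hxy).ne, h.1⟩, h.2⟩⟩
          have h2 : (F.filter (· < y)).card = ((F.erase x).filter (· < y)).card + 1 := by
            rw [Finset.filter_erase, Finset.card_erase_add_one]
            simp [hx, hxy]
          rw [h1, h2, pow_succ]; ring
        rcases lt_or_gt_of_ne hwv with hlt | hlt
        · rw [add_comm, aux w v hw hv hlt, Finsupp.single_zero]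
        · rw [aux v w hv hw hlt, Finsupp.single_zero]
      · rintro ⟨v, w⟩ h _ heq
        simp only [Finset.mem_sigma, Finset.mem_erase] at h
        exact h.2.1 (by simpa using congrArg Sigma.fst heq)
      · rintro ⟨v, w⟩ h
        simp only [Finset.mem_sigma, Finset.mem_erase] at h ⊢
        exact ⟨h.2.2, fun e => h.2.1 e.symm, h.1⟩
      · rintro ⟨v, w⟩ _
        rfl
    have key' := congrArg (a • ·) key
    simp only [Finset.smul_sum, Finsupp.smul_single, smul_eq_mul, smul_zero] at key'
    simpa only [mul_assoc] using key'

theorem boundary_mem_chains {X : PreAbstractSimplicialComplex V} {j : ℕ} {c : Finset V →₀ 𝕜}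
    (hc : c ∈ chains 𝕜 X (j + 1)) : boundary 𝕜 c ∈ chains 𝕜 X j := by
  rw [← c.sum_single, Finsupp.sum, map_sum]
  refine Submodule.sum_mem _ fun F hF => ?_
  rw [boundary_single]
  refine Submodule.smul_mem _ _ (Submodule.sum_mem _ fun v hv => ?_)
  obtain ⟨hcard, hX⟩ := (Finsupp.mem_supported 𝕜 c).1 hc hF
  refine Finsupp.single_mem_supported 𝕜 _ ⟨by rw [Finset.card_erase_of_mem hv, hcard]; rfl, ?_⟩
  rcases Finset.eq_empty_or_nonempty (F.erase v) with he | hne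
  · exact Or.inl he
  · rcases hX with rfl | hX
    · simp at hv
    · exact Or.inr ((X.isRelLowerSet_faces hX).2 (Finset.erase_subset v F) hne)

theorem boundaries_le_cycles (X : PreAbstractSimplicialComplex V) (j : ℕ) :
    boundaries 𝕜 X j ≤ cycles 𝕜 X j := by
  rintro _ ⟨c, hc, rfl⟩
  exact ⟨boundary_mem_chains 𝕜 hc, boundary_boundary 𝕜 c⟩

end Chains

/-- An auxiliary linear order on the vertices, used to orient the simplices. (The homology does not
depend on it up to isomorphism.) -/
@[reducible] noncomputable def vertexOrder (V : Type*) : LinearOrder V :=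
  open Classical in linearOrderOfSTO (WellOrderingRel : V → V → Prop)

/-- The `j` with `H̃_{j-1}(X[S]; 𝕜) ≠ 0` for some set `S` of vertices. -/
def regularitySet (𝕜 : Type*) [Field 𝕜] {V : Type*} (X : AbstractSimplicialComplex V) : Set ℕ :=
  let _ := vertexOrder V
  {j | ∃ S : Set V, Nontrivial (ReducedHomology 𝕜 (induced X.toPreAbstractSimplicialComplex S) j)}

/-- The Castelnuovo-Mumford regularity
`reg_𝕜(X) = max {j : H̃_{j-1}(X[S]; 𝕜) ≠ 0 for some S ⊆ V}` of a simplicial complex on a finite vertex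
set. It is a maximum by `isGreatest_regularity`. -/
noncomputable def regularity (𝕜 : Type*) [Field 𝕜] {V : Type*} (X : AbstractSimplicialComplex V) : ℕ :=
  sSup (regularitySet 𝕜 X)

theorem isGreatest_regularity (𝕜 : Type*) [Field 𝕜] {V : Type*} [Finite V]
    (X : AbstractSimplicialComplex V) : IsGreatest (regularitySet 𝕜 X) (regularity 𝕜 X) := by
  let _ := vertexOrder V
  have := Fintype.ofFinite V
  have hne : (regularitySet 𝕜 X).Nonempty := by
    refine ⟨0, ∅, (nontrivial_subquotient_iff _ _).2 fun hle => ?_⟩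
    have hmem : (Finsupp.single (∅ : Finset V) (1 : 𝕜)) ∈
        cycles 𝕜 (induced X.toPreAbstractSimplicialComplex ∅) 0 :=
      ⟨Finsupp.single_mem_supported 𝕜 _ ⟨rfl, Or.inl rfl⟩, by simp [boundary_single]⟩
    obtain ⟨c, hc, hc'⟩ := hle hmem
    have h0 : c = 0 := by
      by_contra h0
      obtain ⟨F, hF⟩ := Finsupp.support_nonempty_iff.2 h0
      obtain ⟨hcard, hX⟩ := (Finsupp.mem_supported 𝕜 c).1 hc hF
      rcases hX with rfl | hX
      · simp at hcard
      · have := Set.subset_empty_iff.1 hX.2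
        rw [Finset.coe_eq_empty] at this
        simp [this] at hcard
    simp [h0] at hc'
    simpa using congrArg (· ∅) hc'
  have hbdd : BddAbove (regularitySet 𝕜 X) := by
    refine ⟨Fintype.card V, ?_⟩
    rintro j ⟨S, hS⟩
    by_contra hlt
    refine (nontrivial_subquotient_iff _ _).1 hS fun c hc => ?_
    have h0 : c = 0 := by
      by_contra h0
      obtain ⟨F, hF⟩ := Finsupp.support_nonempty_iff.2 h0
      obtain ⟨hcard, -⟩ := (Finsupp.mem_supported 𝕜 c).1 hc.1 hF
      exact hlt (hcard ▸ F.card_le_univ)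
    rw [h0]
    exact Submodule.zero_mem _
  exact ⟨Nat.sSup_mem hne hbdd, fun j hj => le_csSup hbdd hj⟩

end SimplicialHomology

/-- The regularity of a graph is the regularity of its independence complex. -/
noncomputable def SimpleGraph.reg (𝕜 : Type*) [Field 𝕜] {V : Type*} (G : SimpleGraph V) : ℕ :=
  SimplicialHomology.regularity 𝕜 G.indComplex

namespace SimplicialHomology

/-! Let `P` be the set of original vertices, `Q` the set of edge vertices, `X` an induced subcomplex
of the independence complex of `S(G)`, and `U` the union of the closed stars in `X` of the vertices
of `Q`. Edge vertices are pairwise nonadjacent, so whether one can be added to a face depends only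
on the part of the face in `P`. Hence `U` is empty or acyclic
(`exists_boundary_eq_of_mem_starFaces`). No `P \ {v}` lies in `U`, since every edge has an end other
than `v`.

Upper bound, for any `G` (`cycles_le_boundaries_of_card_le`): in a cycle on faces with at least
`|P|` vertices, the coefficient at `P` vanishes, because only `P` can lie over `P \ {v}`. The other
faces meet `Q`, so the cycle lives in `U` and bounds.

Lower bound (`not_cycles_le_boundaries`): for a side `A` of the bipartition, let `z` be the part of
`∂P` on the faces `P \ {a}`, `a ∈ A`. Its boundary lives on faces `P \ {a, b}` with `b ∉ A`, which
lie in the star of the edge `ab`; so `z - u` is a cycle for some `u` in `U`. A boundary `∂d` has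
coefficient `± d(P)` at every `P \ {v}`, but `z - u` is `± 1` for `v ∈ A` and `0` for `v ∉ A`. -/

theorem mem_of_subset_mem {V : Type*} {X : PreAbstractSimplicialComplex V} {F G : Finset V}
    (hG : G ∈ X) (h : F ⊆ G) (hne : F.Nonempty) : F ∈ X :=
  (X.isRelLowerSet_faces hG).2 h hne

/-! ### Signs and the cone homotopy -/

section Cone

variable (𝕜 : Type*) [Field 𝕜] {V : Type*} [LinearOrder V]

/-- The sign `(-1) ^ k`, where `k` is the number of elements of `F` below `v`. -/
def positionSign (F : Finset V) (v : V) : 𝕜 := (-1) ^ (F.filter (· < v)).card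

theorem positionSign_mul_self (F : Finset V) (v : V) :
    positionSign 𝕜 F v * positionSign 𝕜 F v = 1 := by
  rw [positionSign, ← pow_add, Even.neg_one_pow ⟨_, rfl⟩]

theorem positionSign_ne_zero (F : Finset V) (v : V) : positionSign 𝕜 F v ≠ 0 :=
  left_ne_zero_of_mul_eq_one (positionSign_mul_self 𝕜 F v)

theorem positionSign_insert_self (F : Finset V) (v : V) :
    positionSign 𝕜 (insert v F) v = positionSign 𝕜 F v := by
  simp [positionSign, Finset.filter_insert]

theorem positionSign_erase_self (F : Finset V) (v : V) :
    positionSign 𝕜 (F.erase v) v = positionSign 𝕜 F v := by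
  simp [positionSign, Finset.filter_erase]

/-- Exactly one of the two positions shifts by one: that of `q` if `v < q`, that of `v` if `q < v`.
This sign makes the cross terms of the cone homotopy cancel. -/
theorem positionSign_insert_mul {F : Finset V} {v q : V} (hv : v ∈ F) (hq : q ∉ F) :
    positionSign 𝕜 (insert q F) v * positionSign 𝕜 F q =
      -(positionSign 𝕜 F v * positionSign 𝕜 (F.erase v) q) := by
  simp only [positionSign, Finset.filter_insert, Finset.filter_erase]
  rcases lt_or_gt_of_ne (ne_of_mem_of_not_mem hv hq) with h | h
  · have hmem : v ∈ F.filter (· < q) := by simp [hv, h]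
    rw [if_neg h.not_gt, ← Finset.card_erase_add_one hmem, pow_succ]
    ring
  · rw [if_pos h, Finset.card_insert_of_notMem (by simp [hq]),
      Finset.erase_eq_of_notMem (by simp [h.le]), pow_succ]
    ring

theorem boundary_single_one (F : Finset V) : boundary 𝕜 (Finsupp.single F 1) =
    ∑ v ∈ F, Finsupp.single (F.erase v) (positionSign 𝕜 F v) := by
  rw [boundary_single, one_smul]; rfl

/-- The signed cone operator `F ↦ ± F ∪ {q}`, vanishing on the simplices that contain `q`. -/
noncomputable def cone (q : V) : (Finset V →₀ 𝕜) →ₗ[𝕜] (Finset V →₀ 𝕜) :=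
  Finsupp.lsum 𝕜 fun F => LinearMap.toSpanSingleton 𝕜 (Finset V →₀ 𝕜)
    (if q ∈ F then 0 else Finsupp.single (insert q F) (positionSign 𝕜 F q))

theorem cone_single_of_mem {q : V} {F : Finset V} (h : q ∈ F) (a : 𝕜) :
    cone 𝕜 q (Finsupp.single F a) = 0 := by
  simp [cone, h]

theorem cone_single_of_notMem {q : V} {F : Finset V} (h : q ∉ F) (a : 𝕜) :
    cone 𝕜 q (Finsupp.single F a) = Finsupp.single (insert q F) (a * positionSign 𝕜 F q) := by
  simp [cone, h]

theorem boundary_cone_add_cone_boundary (q : V) (F : Finset V) :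
    boundary 𝕜 (cone 𝕜 q (Finsupp.single F 1)) + cone 𝕜 q (boundary 𝕜 (Finsupp.single F 1)) =
      Finsupp.single F 1 := by
  rw [boundary_single_one, map_sum]
  by_cases hq : q ∈ F
  · rw [cone_single_of_mem 𝕜 hq, map_zero, zero_add, Finset.sum_eq_single_of_mem q hq,
      cone_single_of_notMem 𝕜 (Finset.notMem_erase q F), Finset.insert_erase hq,
      positionSign_erase_self, positionSign_mul_self]
    intro v _ hv
    exact cone_single_of_mem 𝕜 (Finset.mem_erase.2 ⟨hv.symm, hq⟩) _
  · rw [cone_single_of_notMem 𝕜 hq, one_mul, ← mul_one (positionSign 𝕜 F q), ← smul_eq_mul,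
      ← Finsupp.smul_single, map_smul, boundary_single_one, Finset.sum_insert hq,
      Finset.erase_insert hq, positionSign_insert_self, smul_add, Finsupp.smul_single,
      smul_eq_mul, positionSign_mul_self, add_assoc, Finset.smul_sum, ← Finset.sum_add_distrib,
      Finset.sum_eq_zero, add_zero]
    intro v hv
    have hvq : v ≠ q := ne_of_mem_of_not_mem hv hq
    rw [cone_single_of_notMem 𝕜 (fun h => hq (Finset.mem_of_mem_erase h)),
      Finset.erase_insert_of_ne hvq.symm, Finsupp.smul_single, smul_eq_mul, ← Finsupp.single_add,
      mul_comm, positionSign_insert_mul 𝕜 hv hq, neg_add_cancel, Finsupp.single_zero]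

/-- The coefficient of `∂ c` at `G`, when `G ∪ {v}` is the only simplex of `c` over `G`. -/
theorem boundary_apply_of_unique {c : Finset V →₀ 𝕜} {G : Finset V} {v : V} (hv : v ∉ G)
    (h : ∀ u ∉ G, u ≠ v → c (insert u G) = 0) :
    boundary 𝕜 c G = positionSign 𝕜 G v * c (insert v G) := by
  have hc : c = c.sum fun F a => a • Finsupp.single F 1 := by simp
  conv_lhs => rw [hc]
  rw [Finsupp.sum, map_sum, Finsupp.finsetSum_apply, Finset.sum_eq_single (insert v G)]
  · rw [map_smul, boundary_single_one, Finset.sum_insert hv, Finset.erase_insert hv,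
      positionSign_insert_self, Finsupp.smul_apply, Finsupp.add_apply, Finsupp.single_eq_same,
      Finsupp.finsetSum_apply, Finset.sum_eq_zero, add_zero, smul_eq_mul, mul_comm]
    intro u hu
    refine Finsupp.single_eq_of_ne fun he => ?_
    rw [he] at hu
    simp at hu
  · intro F hF hne
    rw [map_smul, boundary_single_one, Finsupp.smul_apply, Finsupp.finsetSum_apply,
      Finset.sum_eq_zero, smul_zero]
    intro u hu
    refine Finsupp.single_eq_of_ne fun he => ?_
    have hF' : insert u G = F := by rw [he, Finset.insert_erase hu]
    have huG : u ∉ G := by rw [he]; exact Finset.notMem_erase u F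
    refine Finsupp.mem_support_iff.1 hF ?_
    rw [← hF']
    exact h u huG fun huv => hne (by rw [← hF', huv])
  · intro hn
    rw [Finsupp.notMem_support_iff.1 hn]
    simp

variable {𝕜}

theorem boundary_mem_supported {s t : Set (Finset V)} (h : ∀ F ∈ s, ∀ v ∈ F, F.erase v ∈ t)
    {c : Finset V →₀ 𝕜} (hc : c ∈ Finsupp.supported 𝕜 𝕜 s) :
    boundary 𝕜 c ∈ Finsupp.supported 𝕜 𝕜 t := by
  rw [← c.sum_single, Finsupp.sum, map_sum]
  refine Submodule.sum_mem _ fun F hF => ?_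
  rw [boundary_single]
  exact Submodule.smul_mem _ _ (Submodule.sum_mem _ fun v hv =>
    Finsupp.single_mem_supported 𝕜 _ (h F ((Finsupp.mem_supported 𝕜 c).1 hc hF) v hv))

end Cone

/-! ### Acyclicity of a union of stars, and its homological consequences -/

section Star

variable (𝕜 : Type*) [Field 𝕜] {V : Type*} [LinearOrder V]

/-- The simplices with `j` vertices in the union of the closed stars of the vertices in `Q`. -/
def starFaces (X : PreAbstractSimplicialComplex V) (Q : Set V) (j : ℕ) : Set (Finset V) :=
  {F | F.card = j ∧ ∃ q ∈ Q, insert q F ∈ X}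

theorem starFaces_subset (X : PreAbstractSimplicialComplex V) (Q : Set V) (j : ℕ) :
    starFaces X Q j ⊆ {F | F.card = j ∧ (F = ∅ ∨ F ∈ X)} := by
  rintro F ⟨hF, q, -, hq⟩
  exact ⟨hF, F.eq_empty_or_nonempty.imp_right (mem_of_subset_mem hq (Finset.subset_insert q F))⟩

/-- A face extends by the vertices `q ∈ Q` by which its part outside `Q` extends. -/
def IsConeClosed (X : PreAbstractSimplicialComplex V) (Q : Set V) : Prop :=
  ∀ F : Finset V, ∀ q ∈ Q, (F = ∅ ∨ F ∈ X) → ∀ G ⊆ F, (∀ v ∈ F, v ∉ Q → v ∈ G) →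
    insert q G ∈ X → insert q F ∈ X

open Classical in
/-- The simplices of `starFaces X Q j` with fewer than `k` vertices outside `Q`. -/
def starFacesLT (X : PreAbstractSimplicialComplex V) (Q : Set V) (j k : ℕ) : Set (Finset V) :=
  {F | F ∈ starFaces X Q j ∧ (F.filter (· ∉ Q)).card < k}

theorem cone_single_mem_starFacesLT {X : PreAbstractSimplicialComplex V} {Q : Set V} {q : V}
    {F : Finset V} (hq : q ∈ Q) (hF : insert q F ∈ X) {k : ℕ}
    (hk : open Classical in (F.filter (· ∉ Q)).card < k) (a : 𝕜) :
    cone 𝕜 q (Finsupp.single F a) ∈ Finsupp.supported 𝕜 𝕜 (starFacesLT X Q (F.card + 1) k) := by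
  by_cases hqF : q ∈ F
  · rw [cone_single_of_mem 𝕜 hqF]; exact Submodule.zero_mem _
  · rw [cone_single_of_notMem 𝕜 hqF]
    refine Finsupp.single_mem_supported 𝕜 _
      ⟨⟨Finset.card_insert_of_notMem hqF, q, hq, by simpa using hF⟩, ?_⟩
    rwa [Finset.filter_insert, if_neg (not_not.2 hq)]

-- The apex is chosen from the part of `F` outside `Q` alone, so deleting a vertex of `Q` from `F`
-- does not change it.
open Classical in
theorem exists_apex {X : PreAbstractSimplicialComplex V} {Q : Set V} (hX : IsConeClosed X Q)
    (hQ : Q.Nonempty) : ∃ apex : Finset V → V, ∀ F : Finset V, (∃ q ∈ Q, insert q F ∈ X) →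
      apex (F.filter (· ∉ Q)) ∈ Q ∧ insert (apex (F.filter (· ∉ Q))) F ∈ X := by
  have h : ∀ G : Finset V, ∃ q, (∃ q ∈ Q, insert q G ∈ X) → q ∈ Q ∧ insert q G ∈ X := by
    intro G
    by_cases hG : ∃ q ∈ Q, insert q G ∈ X
    · obtain ⟨q, hq⟩ := hG
      exact ⟨q, fun _ => hq⟩
    -- An arbitrary value, to make the choice of apex total.
    · exact ⟨hQ.some, fun h => absurd h hG⟩
  choose apex hapex using h
  refine ⟨apex, fun F hF => ?_⟩
  obtain ⟨q, hq, hqF⟩ := hF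
  obtain ⟨h1, h2⟩ := hapex (F.filter (· ∉ Q)) ⟨q, hq, mem_of_subset_mem hqF
    (Finset.insert_subset_insert q (Finset.filter_subset _ F)) (Finset.insert_nonempty _ _)⟩
  exact ⟨h1, hX F _ h1
    (F.eq_empty_or_nonempty.imp_right (mem_of_subset_mem hqF (Finset.subset_insert q F))) _
    (Finset.filter_subset _ F) (fun v hv hvQ => Finset.mem_filter.2 ⟨hv, hvQ⟩) h2⟩

open Classical in
/-- The operator coning each simplex over the apex assigned to its part outside `Q`. -/
noncomputable def apexCone (Q : Set V) (apex : Finset V → V) :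
    (Finset V →₀ 𝕜) →ₗ[𝕜] (Finset V →₀ 𝕜) :=
  Finsupp.lsum 𝕜 fun F => LinearMap.toSpanSingleton 𝕜 (Finset V →₀ 𝕜)
    (cone 𝕜 (apex (F.filter (· ∉ Q))) (Finsupp.single F 1))

open Classical in
theorem apexCone_single (Q : Set V) (apex : Finset V → V) (F : Finset V) (a : 𝕜) :
    apexCone 𝕜 Q apex (Finsupp.single F a) =
      cone 𝕜 (apex (F.filter (· ∉ Q))) (Finsupp.single F a) := by
  have : Finsupp.single F a = a • Finsupp.single F (1 : 𝕜) := by simp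
  rw [this, map_smul, map_smul]
  simp [apexCone]

open Classical in
/-- `apexCone` is a contracting homotopy up to simplices with fewer vertices outside `Q`. -/
theorem sub_boundary_apexCone_mem {X : PreAbstractSimplicialComplex V} {Q : Set V}
    {apex : Finset V → V} (hapex : ∀ F : Finset V, (∃ q ∈ Q, insert q F ∈ X) →
      apex (F.filter (· ∉ Q)) ∈ Q ∧ insert (apex (F.filter (· ∉ Q))) F ∈ X)
    {j k : ℕ} {c : Finset V →₀ 𝕜}
    (hc : c ∈ Finsupp.supported 𝕜 𝕜 (starFacesLT X Q j (k + 1))) :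
    c - boundary 𝕜 (apexCone 𝕜 Q apex c) - apexCone 𝕜 Q apex (boundary 𝕜 c) ∈
      Finsupp.supported 𝕜 𝕜 (starFacesLT X Q j k) := by
  let T : (Finset V →₀ 𝕜) →ₗ[𝕜] (Finset V →₀ 𝕜) := LinearMap.id -
    boundary 𝕜 ∘ₗ apexCone 𝕜 Q apex - apexCone 𝕜 Q apex ∘ₗ boundary 𝕜
  suffices h : Finsupp.supported 𝕜 𝕜 (starFacesLT X Q j (k + 1)) ≤
      (Finsupp.supported 𝕜 𝕜 (starFacesLT X Q j k)).comap T from h hc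
  rw [Finsupp.supported_eq_span_single, Submodule.span_le]
  rintro _ ⟨F, ⟨hF, hFk⟩, rfl⟩
  obtain ⟨hq, hqF⟩ := hapex F hF.2
  change Finsupp.single F 1 - boundary 𝕜 (apexCone 𝕜 Q apex (Finsupp.single F 1)) -
    apexCone 𝕜 Q apex (boundary 𝕜 (Finsupp.single F 1)) ∈
      Finsupp.supported 𝕜 𝕜 (starFacesLT X Q j k)
  -- By the homotopy for the apex of `F`, what remains is a sum over `v ∈ F`: the cone on `F \ {v}`
  -- over the apex of `F`, minus the cone over its own apex. These agree if `v ∈ Q`; otherwise both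
  -- have lost a vertex outside `Q`.
  rw [apexCone_single, sub_eq_of_eq_add'
    (boundary_cone_add_cone_boundary 𝕜 (apex (F.filter (· ∉ Q))) F).symm, boundary_single_one,
    map_sum, map_sum, ← Finset.sum_sub_distrib]
  refine Submodule.sum_mem _ fun v hv => ?_
  rw [apexCone_single]
  by_cases hvQ : v ∈ Q
  · rw [Finset.filter_erase,
      Finset.erase_eq_of_notMem (s := F.filter (· ∉ Q)) (by simp [hvQ]), sub_self]
    exact Submodule.zero_mem _
  · have hsub : insert (apex (F.filter (· ∉ Q))) (F.erase v) ∈ X := mem_of_subset_mem hqF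
      (Finset.insert_subset_insert _ (Finset.erase_subset v F)) (Finset.insert_nonempty _ _)
    have hcard : (F.erase v).card + 1 = j := by rw [Finset.card_erase_add_one hv, hF.1]
    have hlt : ((F.erase v).filter (· ∉ Q)).card < k := by
      have := Finset.card_erase_lt_of_mem (s := F.filter (· ∉ Q)) (a := v) (by simp [hv, hvQ])
      rw [Finset.filter_erase]
      omega
    obtain ⟨hq', hqF'⟩ := hapex (F.erase v) ⟨_, hq, hsub⟩
    rw [← hcard]
    exact Submodule.sub_mem _ (cone_single_mem_starFacesLT 𝕜 hq hsub hlt _)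
      (cone_single_mem_starFacesLT 𝕜 hq' hqF' hlt _)

open Classical in
theorem apexCone_mem {X : PreAbstractSimplicialComplex V} {Q : Set V}
    {apex : Finset V → V} (hapex : ∀ F : Finset V, (∃ q ∈ Q, insert q F ∈ X) →
      apex (F.filter (· ∉ Q)) ∈ Q ∧ insert (apex (F.filter (· ∉ Q))) F ∈ X)
    {j : ℕ} {c : Finset V →₀ 𝕜} (hc : c ∈ Finsupp.supported 𝕜 𝕜 (starFaces X Q j)) :
    apexCone 𝕜 Q apex c ∈ Finsupp.supported 𝕜 𝕜 (starFaces X Q (j + 1)) := by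
  rw [← c.sum_single, Finsupp.sum, map_sum]
  refine Submodule.sum_mem _ fun F hF => ?_
  obtain ⟨hcard, hF⟩ := (Finsupp.mem_supported 𝕜 c).1 hc hF
  obtain ⟨hq, hqF⟩ := hapex F hF
  rw [apexCone_single, ← hcard]
  exact Finsupp.supported_mono (fun _ h => h.1)
    (cone_single_mem_starFacesLT 𝕜 hq hqF (Nat.lt_succ_self _) _)

/-- The union of the closed stars of the vertices in `Q` is acyclic. -/
theorem exists_boundary_eq_of_mem_starFaces {X : PreAbstractSimplicialComplex V} {Q : Set V}
    (hX : IsConeClosed X Q) {j : ℕ} {c : Finset V →₀ 𝕜}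
    (hc : c ∈ Finsupp.supported 𝕜 𝕜 (starFaces X Q j)) (hc0 : boundary 𝕜 c = 0) :
    ∃ d ∈ Finsupp.supported 𝕜 𝕜 (starFaces X Q (j + 1)), boundary 𝕜 d = c := by
  classical
  rcases Q.eq_empty_or_nonempty with rfl | hQ
  · refine ⟨0, Submodule.zero_mem _, ?_⟩
    have : starFaces X ∅ j = ∅ := by simp [starFaces]
    rw [this, Finsupp.supported_empty, Submodule.mem_bot] at hc
    rw [hc, map_zero]
  obtain ⟨apex, hapex⟩ := exists_apex hX hQ
  -- Induction on a bound for the number of vertices outside `Q`: subtracting the boundary of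
  -- `apexCone` lowers it by one.
  suffices h : ∀ (k : ℕ) (c : Finset V →₀ 𝕜),
      c ∈ Finsupp.supported 𝕜 𝕜 (starFacesLT X Q j k) → boundary 𝕜 c = 0 →
      ∃ d ∈ Finsupp.supported 𝕜 𝕜 (starFaces X Q (j + 1)), boundary 𝕜 d = c by
    have hsub : starFaces X Q j ⊆ starFacesLT X Q j (j + 1) := fun F hF =>
      ⟨hF, Nat.lt_succ_of_le ((Finset.card_filter_le _ _).trans hF.1.le)⟩
    exact h (j + 1) c (Finsupp.supported_mono hsub hc) hc0
  intro k
  induction k with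
  | zero =>
    intro c hc _
    refine ⟨0, Submodule.zero_mem _, ?_⟩
    have : starFacesLT X Q j 0 = ∅ := by simp [starFacesLT]
    rw [this, Finsupp.supported_empty, Submodule.mem_bot] at hc
    rw [hc, map_zero]
  | succ k ih =>
    intro c hc hc0
    have hmem := sub_boundary_apexCone_mem 𝕜 hapex hc
    rw [hc0, map_zero, sub_zero] at hmem
    obtain ⟨d, hd, hdc⟩ := ih _ hmem (by rw [map_sub, hc0, boundary_boundary, sub_zero])
    refine ⟨d + apexCone 𝕜 Q apex c, Submodule.add_mem _ hd
      (apexCone_mem 𝕜 hapex (Finsupp.supported_mono (fun _ h => h.1) hc)), ?_⟩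
    rw [map_add, hdc, sub_add_cancel]

/-- If no face `P \ {v}` extends by a vertex of `Q`, the coefficient of a boundary at `P \ {v}` is,
up to sign, the coefficient of the chain at `P`. -/
theorem boundary_apply_erase {X : PreAbstractSimplicialComplex V} {Q : Set V} {P : Finset V}
    (hPQ : ∀ v, v ∈ P ∨ v ∈ Q) {v : V} (hv : v ∈ P) (hdom : ∀ q ∈ Q, insert q (P.erase v) ∉ X)
    {j : ℕ} {c : Finset V →₀ 𝕜} (hc : c ∈ chains 𝕜 X j) :
    boundary 𝕜 c (P.erase v) = positionSign 𝕜 P v * c P := by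
  rw [boundary_apply_of_unique 𝕜 (Finset.notMem_erase v P), Finset.insert_erase hv,
    positionSign_erase_self]
  intro u hu huv
  by_contra hne
  have huP : u ∉ P := fun h => hu (Finset.mem_erase.2 ⟨huv, h⟩)
  have hmem := (Finsupp.mem_supported 𝕜 c).1 hc (Finsupp.mem_support_iff.2 hne)
  exact hdom u ((hPQ u).resolve_left huP)
    (hmem.2.resolve_left (Finset.insert_nonempty _ _).ne_empty)

/-- A face avoiding `Q` lies in `P`, so with at least `P.card` vertices it must be `P`; a vanishing
coefficient at `P` thus puts the whole cycle in the stars. -/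
theorem cycles_le_boundaries_of_card_le {X : PreAbstractSimplicialComplex V} {Q : Set V}
    (hX : IsConeClosed X Q) {P : Finset V} (hPQ : ∀ v, v ∈ P ∨ v ∈ Q) {v : V} (hv : v ∈ P)
    (hdom : ∀ q ∈ Q, insert q (P.erase v) ∉ X) {j : ℕ} (hj : P.card ≤ j) :
    cycles 𝕜 X j ≤ boundaries 𝕜 X j := by
  rintro c ⟨hc, hc0⟩
  have hcP : c P = 0 := by
    have h := boundary_apply_erase 𝕜 hPQ hv hdom hc
    rw [LinearMap.mem_ker.1 hc0] at h
    exact (mul_eq_zero.1 h.symm).resolve_left (positionSign_ne_zero 𝕜 P v)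
  suffices h : c ∈ Finsupp.supported 𝕜 𝕜 (starFaces X Q j) by
    obtain ⟨d, hd, hdc⟩ := exists_boundary_eq_of_mem_starFaces 𝕜 hX h hc0
    exact ⟨d, Finsupp.supported_mono (starFaces_subset X Q _) hd, hdc⟩
  refine (Finsupp.mem_supported 𝕜 c).2 fun F hF => ?_
  obtain ⟨hcard, hFX⟩ := (Finsupp.mem_supported 𝕜 c).1 hc hF
  refine ⟨hcard, ?_⟩
  by_cases hFQ : ∃ q ∈ Q, q ∈ F
  · obtain ⟨q, hq, hqF⟩ := hFQ
    refine ⟨q, hq, ?_⟩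
    rw [Finset.insert_eq_of_mem hqF]
    exact hFX.resolve_left (Finset.ne_empty_of_mem hqF)
  · have hFP : F ⊆ P := fun u hu => (hPQ u).resolve_right fun h => hFQ ⟨u, h, hu⟩
    rw [Finset.eq_of_subset_of_card_le hFP (hcard ▸ hj)] at hF
    exact absurd hcP (Finsupp.mem_support_iff.1 hF)

theorem not_cycles_le_boundaries {X : PreAbstractSimplicialComplex V} {Q : Set V}
    (hX : IsConeClosed X Q) {P A : Finset V} (hPQ : ∀ v, v ∈ P ∨ v ∈ Q)
    (hface : ∀ v ∈ P, P.erase v ∈ X) (hdom : ∀ v ∈ P, ∀ q ∈ Q, insert q (P.erase v) ∉ X)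
    (hstar : ∀ a ∈ A, ∀ b ∈ P \ A, ∃ q ∈ Q, insert q ((P.erase a).erase b) ∈ X)
    (hAP : A ⊆ P) {a b : V} (ha : a ∈ A) (hb : b ∈ P \ A) :
    ¬ cycles 𝕜 X (P.card - 1) ≤ boundaries 𝕜 X (P.card - 1) := by
  intro hle
  obtain ⟨hbP, hbA⟩ := Finset.mem_sdiff.1 hb
  have haP := hAP ha
  have hne : a ≠ b := fun h => hbA (h ▸ ha)
  obtain ⟨N, hN⟩ : ∃ N, P.card = N + 2 := by
    have := Finset.card_erase_add_one (Finset.mem_erase.2 ⟨hne.symm, hbP⟩)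
    have := Finset.card_erase_add_one haP
    exact ⟨((P.erase a).erase b).card, by omega⟩
  rw [hN] at hle
  let z (B : Finset V) : Finset V →₀ 𝕜 :=
    ∑ v ∈ B, Finsupp.single (P.erase v) (positionSign 𝕜 P v)
  have hz (B : Finset V) :
      z B ∈ Finsupp.supported 𝕜 𝕜 {F : Finset V | ∃ v ∈ B, F = P.erase v} :=
    Submodule.sum_mem _ fun v hv => Finsupp.single_mem_supported 𝕜 _ ⟨v, hv, rfl⟩
  have hzbd (B : Finset V) : boundary 𝕜 (z B) ∈ Finsupp.supported 𝕜 𝕜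
      {F : Finset V | ∃ v ∈ B, ∃ w ∈ P.erase v, F = (P.erase v).erase w} :=
    boundary_mem_supported (by rintro _ ⟨v, hv, rfl⟩ w hw; exact ⟨v, hv, w, hw, rfl⟩) (hz B)
  -- The two halves of `∂P` have opposite boundaries, so each face occurring there misses a vertex
  -- of `A` and also one of `P \ A`.
  have hsum : boundary 𝕜 (z A) = -boundary 𝕜 (z (P \ A)) := by
    have h := boundary_boundary 𝕜 (Finsupp.single P (1 : 𝕜))
    rw [boundary_single_one, ← Finset.sum_sdiff hAP, map_add] at h
    exact eq_neg_of_add_eq_zero_right h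
  have hzU : boundary 𝕜 (z A) ∈ Finsupp.supported 𝕜 𝕜 (starFaces X Q N) := by
    refine (Finsupp.mem_supported 𝕜 _).2 fun F hF => ?_
    obtain ⟨v, hv, w, hw, rfl⟩ := (Finsupp.mem_supported 𝕜 _).1 (hzbd A) hF
    rw [hsum, Finsupp.support_neg] at hF
    obtain ⟨v', hv', w', -, he⟩ := (Finsupp.mem_supported 𝕜 _).1 (hzbd (P \ A)) hF
    have hvv' : v' ≠ v := fun h => (Finset.mem_sdiff.1 hv').2 (h ▸ hv)
    have hw' : v' = w := by
      by_contra hne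
      have : v' ∈ (P.erase v).erase w :=
        Finset.mem_erase.2 ⟨hne, Finset.mem_erase.2 ⟨hvv', (Finset.mem_sdiff.1 hv').1⟩⟩
      rw [he] at this
      simp at this
    subst hw'
    refine ⟨?_, hstar v hv v' hv'⟩
    rw [Finset.card_erase_of_mem hw, Finset.card_erase_of_mem (hAP hv), hN]
    rfl
  obtain ⟨u, hu, hub⟩ := exists_boundary_eq_of_mem_starFaces 𝕜 hX hzU (boundary_boundary 𝕜 _)
  have hu0 : ∀ v ∈ P, u (P.erase v) = 0 := by
    intro v hv
    by_contra h
    obtain ⟨-, q, hq, hqX⟩ := (Finsupp.mem_supported 𝕜 u).1 hu (Finsupp.mem_support_iff.2 h)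
    exact hdom v hv q hq hqX
  obtain ⟨d, hd, hdz⟩ : z A - u ∈ boundaries 𝕜 X (N + 1) := by
    have hsub : {F : Finset V | ∃ v ∈ A, F = P.erase v} ⊆
        {F | F.card = N + 1 ∧ (F = ∅ ∨ F ∈ X)} := by
      rintro _ ⟨v, hv, rfl⟩
      refine ⟨?_, Or.inr (hface v (hAP hv))⟩
      rw [Finset.card_erase_of_mem (hAP hv), hN]
      rfl
    refine hle ⟨Submodule.sub_mem _ (Finsupp.supported_mono hsub (hz A))
      (Finsupp.supported_mono (starFaces_subset X Q _) hu), LinearMap.mem_ker.2 ?_⟩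
    rw [map_sub, hub, sub_self]
  have hza : z A (P.erase a) = positionSign 𝕜 P a := by
    rw [Finsupp.finsetSum_apply, Finset.sum_eq_single_of_mem a ha, Finsupp.single_eq_same]
    intro v hv hva
    refine Finsupp.single_eq_of_ne fun he => ?_
    have : v ∈ P.erase a := Finset.mem_erase.2 ⟨hva, hAP hv⟩
    rw [he] at this
    simp at this
  have hzb : z A (P.erase b) = 0 := by
    rw [Finsupp.finsetSum_apply]
    refine Finset.sum_eq_zero fun v hv => Finsupp.single_eq_of_ne fun he => ?_
    have hvb : v ≠ b := fun h => hbA (h ▸ hv)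
    have : v ∈ P.erase b := Finset.mem_erase.2 ⟨hvb, hAP hv⟩
    rw [he] at this
    simp at this
  -- The coefficient at `P \ {b}` forces `d P = 0`, while the one at `P \ {a}` forces it to be
  -- nonzero.
  have ha' := boundary_apply_erase 𝕜 hPQ haP (hdom a haP) hd
  have hb' := boundary_apply_erase 𝕜 hPQ hbP (hdom b hbP) hd
  rw [hdz, Finsupp.sub_apply, hu0 a haP, hza, sub_zero] at ha'
  rw [hdz, Finsupp.sub_apply, hu0 b hbP, hzb, sub_zero] at hb'
  rw [(mul_eq_zero.1 hb'.symm).resolve_left (positionSign_ne_zero 𝕜 P b), mul_zero] at ha'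
  exact positionSign_ne_zero 𝕜 P a ha'

end Star

end SimplicialHomology

/-! ### Application to subdivisions of graphs -/

namespace SimpleGraph

open SimplicialHomology

variable {V : Type*} (G : SimpleGraph V)

theorem mem_induced_indComplex {W : Type*} {H : SimpleGraph W} {S : Set W} {F : Finset W} :
    F ∈ induced H.indComplex.toPreAbstractSimplicialComplex S ↔
      (F.Nonempty ∧ H.IsIndepSet (F : Set W)) ∧ (F : Set W) ⊆ S :=
  Iff.rfl

theorem isIndepSet_insert {W : Type*} {H : SimpleGraph W} {s : Set W} {x : W}
    (hs : H.IsIndepSet s) (h : ∀ y ∈ s, ¬ H.Adj x y) : H.IsIndepSet (insert x s) :=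
  Set.Pairwise.insert hs fun y hy _ => ⟨h y hy, fun h' => h y hy h'.symm⟩

/-- An edge vertex can conflict only with original vertices, and all those of `F` already belong to
`G'`. -/
theorem isConeClosed_induced_indComplex_oneSubdivision [LinearOrder (V ⊕ G.edgeSet)]
    (S : Set (V ⊕ G.edgeSet)) :
    IsConeClosed (induced G.oneSubdivision.indComplex.toPreAbstractSimplicialComplex S)
      (Set.range Sum.inr) := by
  rintro F _ ⟨e, rfl⟩ hF G' hG' hout hX
  rw [mem_induced_indComplex] at hX ⊢
  have hF' : G.oneSubdivision.IsIndepSet (F : Set (V ⊕ G.edgeSet)) ∧ (F : Set _) ⊆ S := by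
    rcases hF with rfl | hF
    · simp [SimpleGraph.IsIndepSet]
    · rw [mem_induced_indComplex] at hF
      exact ⟨hF.1.2, hF.2⟩
  refine ⟨⟨Finset.insert_nonempty _ _, ?_⟩, ?_⟩
  · rw [Finset.coe_insert]
    refine isIndepSet_insert hF'.1 ?_
    rintro (v | f) hv hadj
    · exact hX.1.2 (by simp) (by simpa using hout _ hv (by simp)) hadj.ne hadj
    · exact hadj
  · rw [Finset.coe_insert]
    exact Set.insert_subset (hX.2 (by simp)) hF'.2

variable [Fintype V]

/-- The original vertices in the subdivision `S(G)`. -/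
def originalVertices : Finset (V ⊕ G.edgeSet) := Finset.univ.map Function.Embedding.inl

theorem mem_originalVertices_or (x : V ⊕ G.edgeSet) :
    x ∈ G.originalVertices ∨ x ∈ Set.range (Sum.inr : G.edgeSet → V ⊕ G.edgeSet) := by
  rcases x with v | e <;> simp [originalVertices]

/-- An edge has two distinct ends, so one of them survives the removal of `x`. -/
theorem insert_erase_originalVertices_notMem [LinearOrder (V ⊕ G.edgeSet)]
    (S : Set (V ⊕ G.edgeSet)) (x q : V ⊕ G.edgeSet) (hq : q ∈ Set.range Sum.inr) :
    insert q (G.originalVertices.erase x) ∉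
      induced G.oneSubdivision.indComplex.toPreAbstractSimplicialComplex S := by
  obtain ⟨⟨e, he⟩, rfl⟩ := hq
  rw [mem_induced_indComplex]
  rintro ⟨⟨-, hind⟩, -⟩
  obtain ⟨u, hu, hux⟩ : ∃ u ∈ e, Sum.inl u ≠ x := by
    induction e with
    | h u v =>
      by_cases hux : Sum.inl u = x
      · refine ⟨v, by simp, fun hvx => ?_⟩
        exact (G.ne_of_adj (G.mem_edgeSet.1 he)) (Sum.inl_injective (hux.trans hvx.symm))
      · exact ⟨u, by simp, hux⟩
  refine hind (x := Sum.inr ⟨e, he⟩) (y := Sum.inl u) (by simp)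
    (by simp [originalVertices, hux]) (by simp) ?_
  exact hu

theorem isIndepSet_of_subset_originalVertices {F : Finset (V ⊕ G.edgeSet)}
    (hF : F ⊆ G.originalVertices) : G.oneSubdivision.IsIndepSet (F : Set (V ⊕ G.edgeSet)) := by
  intro x hx y hy _ hadj
  obtain ⟨u, -, rfl⟩ := Finset.mem_map.1 (hF hx)
  obtain ⟨v, -, rfl⟩ := Finset.mem_map.1 (hF hy)
  exact hadj

variable (𝕜 : Type*) [Field 𝕜]

theorem reg_oneSubdivision_lt_card [Nonempty V] :
    G.oneSubdivision.reg 𝕜 < Fintype.card V := by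
  have := Finite.of_injective (Subtype.val : G.edgeSet → Sym2 V) Subtype.val_injective
  let _ := vertexOrder (V ⊕ G.edgeSet)
  obtain ⟨S, hS⟩ := (isGreatest_regularity 𝕜 G.oneSubdivision.indComplex).1
  by_contra! hle
  refine (nontrivial_subquotient_iff _ _).1 hS ?_
  exact cycles_le_boundaries_of_card_le 𝕜
    (G.isConeClosed_induced_indComplex_oneSubdivision S) G.mem_originalVertices_or
    (v := Sum.inl (Classical.arbitrary V)) (by simp [originalVertices])
    (fun q hq => G.insert_erase_originalVertices_notMem S _ q hq)
    (by simpa [originalVertices, reg] using hle)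

/-- If the vertices split into two nonempty parts with all edges between the parts present, the
regularity of the subdivision is the largest possible. -/
theorem card_sub_one_le_reg_oneSubdivision (A : Finset V) {a b : V} (ha : a ∈ A) (hb : b ∉ A)
    (hG : ∀ u ∈ A, ∀ v ∉ A, G.Adj u v) :
    Fintype.card V - 1 ≤ G.oneSubdivision.reg 𝕜 := by
  have := Finite.of_injective (Subtype.val : G.edgeSet → Sym2 V) Subtype.val_injective
  let _ := vertexOrder (V ⊕ G.edgeSet)
  -- The full complex already carries the required homology class.
  refine (isGreatest_regularity 𝕜 G.oneSubdivision.indComplex).2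
    ⟨Set.univ, (nontrivial_subquotient_iff _ _).2 ?_⟩
  have hcard : Fintype.card V = G.originalVertices.card := by simp [originalVertices]
  rw [hcard]
  refine not_cycles_le_boundaries 𝕜 (G.isConeClosed_induced_indComplex_oneSubdivision Set.univ)
    G.mem_originalVertices_or (A := A.map Function.Embedding.inl) ?_
    (fun v _ q hq => G.insert_erase_originalVertices_notMem Set.univ v q hq) ?_
    (Finset.map_subset_map.2 (Finset.subset_univ A)) (a := Sum.inl a) (b := Sum.inl b)
    (by simpa using ha) (by simpa [originalVertices] using hb)
  · intro x _
    refine mem_induced_indComplex.2 ⟨⟨?_, G.isIndepSet_of_subset_originalVertices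
      (Finset.erase_subset _ _)⟩, Set.subset_univ _⟩
    -- Faces must be nonempty: at least one of `a`, `b` remains after erasing `x`.
    by_cases hx : x = Sum.inl a
    · exact ⟨Sum.inl b, by simpa [originalVertices, hx] using fun h : b = a => hb (h ▸ ha)⟩
    · exact ⟨Sum.inl a, by simpa [originalVertices] using fun h : Sum.inl a = x => hx h.symm⟩
  · intro x hx y hy
    obtain ⟨u, hu, rfl⟩ := Finset.mem_map.1 hx
    obtain ⟨hyP, hyA⟩ := Finset.mem_sdiff.1 hy
    obtain ⟨v, -, rfl⟩ := Finset.mem_map.1 hyP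
    have huv : G.Adj u v := hG u hu v fun h => hyA (Finset.mem_map_of_mem _ h)
    refine ⟨Sum.inr ⟨s(u, v), huv⟩, ⟨_, rfl⟩, mem_induced_indComplex.2
      ⟨⟨Finset.insert_nonempty _ _, ?_⟩, Set.subset_univ _⟩⟩
    rw [Finset.coe_insert]
    refine isIndepSet_insert (G.isIndepSet_of_subset_originalVertices
      ((Finset.erase_subset _ _).trans (Finset.erase_subset _ _))) ?_
    rintro (w | f) hw hadj
    · have hw' : w = u ∨ w = v := Sym2.mem_iff.1 hadj
      simp only [Finset.coe_erase, Set.mem_sdiff, Set.mem_singleton_iff] at hw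
      rcases hw' with rfl | rfl
      · exact hw.1.2 rfl
      · exact hw.2 rfl
    · exact hadj

end SimpleGraph

theorem mainTheorem9 (𝕜 : Type*) [Field 𝕜] (n m : ℕ) (hn : 0 < n) (hm : 0 < m) :
    ((completeBipartiteGraph (Fin n) (Fin m)).oneSubdivision).reg 𝕜 = n + m - 1 := by
  have : Nonempty (Fin n ⊕ Fin m) := ⟨Sum.inl ⟨0, hn⟩⟩
  have hlt := (completeBipartiteGraph (Fin n) (Fin m)).reg_oneSubdivision_lt_card 𝕜
  have hge := (completeBipartiteGraph (Fin n) (Fin m)).card_sub_one_le_reg_oneSubdivision 𝕜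
    (Finset.univ.map Function.Embedding.inl) (a := Sum.inl ⟨0, hn⟩) (b := Sum.inr ⟨0, hm⟩)
    (by simp) (by simp) (by rintro (u | u) hu (v | v) hv <;> simp_all)
  rw [Fintype.card_sum, Fintype.card_fin, Fintype.card_fin] at hlt hge
  omega
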